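/- All graphs are finite and simple. For graphs $H$ and $G$, let $\mathrm{Hom}(H,G)$ be the set of homomorphisms from $H$ to $G$, that is, of maps $g:V(H)\to V(G)$ such that $\{g(v),g(w)\}$ is an edge of $G$ whenever $\{v,w\}$ is an edge of $H$. A graph $H$ has Sidorenko's property if for all graphs $G$ $$|\mathrm{Hom}(H,G)|\ \ge\ |V(G)|^{|V(H)|}\left(\frac{2|E(G)|}{|V(G)|^{2}}\right)^{|E(H)|}.$$ The subdivision of a graph $H$ is the graph obtained from $H$ by replacing its edges with paths of length two that are internally vertex disjoint. (i) For every positive integer $k$, the subdivision of the complete graph $K_k$ has Sidorenko's property. (ii) If $H$ has Sidorenko's property, then the subdivision of $H$ also has Sidorenko's property. -/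

import Mathlib

namespace SimpleGraph

/-- A finite graph `H` has Sidorenko's property if for all finite graphs `G`,
`|Hom(H, G)| ≥ |V(G)| ^ |V(H)| * (2 |E(G)| / |V(G)| ^ 2) ^ |E(H)|`.
(Every finite graph is isomorphic to one whose vertex type lies in `Type`. When `V(G)` is empty the
inequality holds, with Lean's `0 / 0 = 0`, for every `H`, so this case adds no restriction.) -/
def HasSidorenkoProperty {V : Type*} [Finite V] (H : SimpleGraph V) : Prop :=
  ∀ (W : Type) [Finite W] (G : SimpleGraph W),
    (Nat.card W : ℝ) ^ Nat.card V *
        (2 * (Nat.card G.edgeSet : ℝ) / (Nat.card W : ℝ) ^ 2) ^ Nat.card H.edgeSet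
      ≤ (Nat.card (H →g G) : ℝ)

/-- The subdivision of `H`: every edge `e = {u, v}` is replaced by a path `u, e, v` through a new
vertex. The vertices are those of `H` together with one new vertex for each edge of `H`; the new
vertex of `e` is adjacent to exactly the two endpoints of `e`. -/
def subdivision {V : Type*} (H : SimpleGraph V) : SimpleGraph (V ⊕ H.edgeSet) where
  Adj
    | .inl v, .inr e => v ∈ (e : Sym2 V)
    | .inr e, .inl v => v ∈ (e : Sym2 V)
    | .inl _, .inl _ => False
    | .inr _, .inr _ => False
  symm := ⟨by rintro (u | e) (v | f) h <;> exact h⟩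
  loopless := ⟨by rintro (u | e) h <;> exact h⟩

end SimpleGraph

/-! Write `n` for the number of vertices of `G`, `C(x, y)` for the number of common neighbours, `d`
for degrees. Homomorphisms from the subdivision of `H` are counted by the sum over maps `f` of the
product of `C(f u, f v)` over the edges of `H`.

(i) Interpolate between a star and the subdivided clique: `u j` counts copies of the subdivided
`K_j` with `k - j` pendant edges at each main vertex. Cauchy-Schwarz gives `u (j+1) ^ 2 ≤ n * u j *
u (j+2)` (`sq_cliqueSum_succ_le`), hence `u 1 ^ k ≤ n ^ k.choose 2 * u k` (`pow_le_of_sq_le_mul`).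
Jensen bounds `u 1`, the sum of `d ^ (k-1)`, from below.

(ii) Apply Sidorenko's inequality for `H` to the kernel `C / n`, whose mean is at least the squared
edge density of `G`. Graphs suffice to get kernels (`HasSidorenkoProperty.kernel`): blow up every
vertex, sample edges independently with the kernel's probabilities, take expectations, and let the
blow-up grow. -/

open Finset Filter Topology

namespace SimpleGraph

/-! ### Counting edges of the subdivision and homomorphisms out of it. -/

section Subdivision

variable {V W : Type*}

/-- The number of edges of the subdivision is twice the number of edges of the graph. -/
theorem card_edgeSet_subdivision [Finite V] (H : SimpleGraph V) :
    Nat.card H.subdivision.edgeSet = 2 * Nat.card H.edgeSet := by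
  classical
  have := Fintype.ofFinite V
  have hd : Nat.card H.Dart = 2 * Nat.card H.edgeSet := by
    rw [Nat.card_eq_fintype_card, H.dart_card_eq_twice_card_edges, Nat.card_eq_fintype_card,
      edgeFinset_card]
  rw [← hd]
  symm
  refine Nat.card_eq_of_bijective
    -- A dart picks an edge and one of its ends, that is, one half of the subdivided edge.
    (fun d : H.Dart => (⟨s(.inl d.fst, .inr ⟨d.edge, d.edge_mem⟩), ?_⟩ : H.subdivision.edgeSet))
    ⟨?_, ?_⟩
  · change d.fst ∈ d.edge
    simp [Dart.edge]
  · intro d d' h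
    have h' := congrArg Subtype.val h
    simp only [Sym2.eq_iff, Sum.inl.injEq, Sum.inr.injEq, Subtype.mk.injEq, reduceCtorEq,
      false_and, or_false] at h'
    rcases (dart_edge_eq_iff d d').1 h'.2 with h'' | h''
    · exact h''
    · have h1 := h'.1
      rw [h''] at h1
      exact absurd h1.symm d'.fst_ne_snd
  · rintro ⟨s, hs⟩
    have key : ∀ (v : V) (e : H.edgeSet), v ∈ (e : Sym2 V) → ∃ d : H.Dart,
        s(Sum.inl d.fst, Sum.inr (⟨d.edge, d.edge_mem⟩ : H.edgeSet)) = s(Sum.inl v, Sum.inr e) := by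
      rintro v ⟨e, he⟩ hv
      obtain ⟨w, rfl⟩ := Sym2.mem_iff_exists.1 hv
      exact ⟨⟨(v, w), he⟩, rfl⟩
    induction s using Sym2.ind with
    | _ a b =>
      rcases a with v | e <;> rcases b with w | f
      · exact absurd hs (fun h : False => h)
      · obtain ⟨d, hd⟩ := key v f hs
        exact ⟨d, Subtype.ext hd⟩
      · obtain ⟨d, hd⟩ := key w e hs
        exact ⟨d, Subtype.ext (hd.trans Sym2.eq_swap)⟩
      · exact absurd hs (fun h : False => h)

/-- Homomorphisms out of the subdivision amount to a map on the old vertices together with a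
common neighbour of the images of the endpoints of each edge. -/
def subdivisionHomEquiv (H : SimpleGraph V) (G : SimpleGraph W) :
    (H.subdivision →g G) ≃
      Σ f : V → W, ∀ e : H.edgeSet, {z : W // ∀ v ∈ (e : Sym2 V), G.Adj (f v) z} where
  toFun g := ⟨fun v => g (.inl v), fun e => ⟨g (.inr e), fun v hv =>
    g.map_adj (show H.subdivision.Adj (.inl v) (.inr e) from hv)⟩⟩
  invFun p :=
    { toFun := Sum.elim p.1 (fun e => (p.2 e).1)
      map_rel' := by
        rintro (v | e) (w | f) h
        · exact h.elim
        · exact (p.2 f).2 v h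
        · exact ((p.2 e).2 w h).symm
        · exact h.elim }
  left_inv g := by
    ext (v | e) <;> rfl
  right_inv p := rfl

open Classical in
/-- The set of common neighbours of the members of an unordered pair. -/
noncomputable def pairCommonNeighbors [Fintype W] (G : SimpleGraph W) (s : Sym2 W) : Finset W :=
  {z | ∀ v ∈ s, G.Adj v z}

theorem card_subdivision_hom [Fintype V] [Fintype W] (H : SimpleGraph V) [Fintype H.edgeSet]
    [DecidableEq V] (G : SimpleGraph W) :
    Nat.card (H.subdivision →g G) =
      ∑ f : V → W, ∏ e : H.edgeSet, #(G.pairCommonNeighbors ((e : Sym2 V).map f)) := by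
  classical
  rw [Nat.card_congr (H.subdivisionHomEquiv G), Nat.card_sigma]
  refine Finset.sum_congr rfl fun f _ => ?_
  rw [Nat.card_pi]
  refine Finset.prod_congr rfl fun e _ => ?_
  rw [Nat.card_eq_fintype_card, Fintype.card_subtype, pairCommonNeighbors]
  congr 1
  ext z
  simp [Sym2.mem_map]

theorem card_pairCommonNeighbors_mk [Fintype W] (G : SimpleGraph W) [DecidableRel G.Adj]
    (x y : W) : (#(G.pairCommonNeighbors s(x, y)) : ℝ) =
      ∑ z, (if G.Adj x z then 1 else 0) * (if G.Adj y z then 1 else 0) := by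
  simp [pairCommonNeighbors, ← ite_and, Finset.sum_boole, and_comm]

theorem sum_ite_adj [Fintype W] (G : SimpleGraph W) [DecidableRel G.Adj] (x : W) :
    ∑ z, (if G.Adj x z then 1 else 0 : ℝ) = G.degree x := by
  rw [Finset.sum_boole, ← card_neighborFinset_eq_degree, neighborFinset_eq_filter]

theorem sum_degree_eq_two_mul_card_edgeSet [Fintype W] (G : SimpleGraph W) [DecidableRel G.Adj] :
    ∑ x, (G.degree x : ℝ) = 2 * (Nat.card G.edgeSet : ℝ) := by
  classical
  rw [Nat.card_eq_fintype_card, ← edgeFinset_card]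
  exact_mod_cast G.sum_degrees_eq_twice_card_edges

/-- Both sides count walks `x, z, y`; the right side groups them by the middle vertex. -/
theorem sum_card_pairCommonNeighbors [Fintype W] (G : SimpleGraph W) [DecidableRel G.Adj] :
    ∑ x, ∑ y, (#(G.pairCommonNeighbors s(x, y)) : ℝ) = ∑ z, (G.degree z : ℝ) ^ 2 := by
  simp_rw [card_pairCommonNeighbors_mk]
  rw [Finset.sum_congr rfl fun x _ => Finset.sum_comm, Finset.sum_comm]
  refine Finset.sum_congr rfl fun z _ => ?_
  rw [sq, ← G.sum_ite_adj z, Finset.sum_mul_sum]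
  simp_rw [G.adj_comm z]

/-- Sidorenko's inequality into a graph without vertices always holds. -/
theorem sidorenko_of_isEmpty [Finite V] (H : SimpleGraph V) [Finite W] [IsEmpty W]
    (G : SimpleGraph W) :
    (Nat.card W : ℝ) ^ Nat.card V *
        (2 * (Nat.card G.edgeSet : ℝ) / (Nat.card W : ℝ) ^ 2) ^ Nat.card H.edgeSet
      ≤ (Nat.card (H →g G) : ℝ) := by
  rcases isEmpty_or_nonempty V with hV | hV
  · have : IsEmpty H.edgeSet := ⟨fun ⟨e, _⟩ => isEmptyElim e⟩
    have h : Nat.card (H →g G) ≠ 0 := by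
      have : Nonempty (H →g G) := ⟨⟨isEmptyElim, fun {a} => isEmptyElim a⟩⟩
      have := Finite.of_injective (fun f : H →g G => (f : V → W)) DFunLike.coe_injective
      exact Nat.card_ne_zero.2 ⟨inferInstance, inferInstance⟩
    simp
  · have : Nat.card V ≠ 0 := Nat.card_ne_zero.2 ⟨inferInstance, inferInstance⟩
    simp [this]

end Subdivision

/-! ### Products over the edges of a complete graph. -/

section PairProd

variable {W : Type*}

/-- The product of a kernel over all pairs `i < l` of coordinates. -/
def pairProd {R : Type*} [CommMonoid R] {j : ℕ} (C : W → W → R) (x : Fin j → W) : R :=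
  ∏ i, ∏ l, if i < l then C (x i) (x l) else 1

theorem pairProd_cons {R : Type*} [CommMonoid R] {j : ℕ} (C : W → W → R) (y : W) (x : Fin j → W) :
    pairProd C (Fin.cons y x : Fin (j + 1) → W) = (∏ i, C y (x i)) * pairProd C x := by
  simp [pairProd, Fin.prod_univ_succ]

theorem prod_edgeSet_completeGraph {R : Type*} [CommMonoid R] (k : ℕ)
    [Fintype (completeGraph (Fin k)).edgeSet] (p : Sym2 W → R) (f : Fin k → W) :
    ∏ e : (completeGraph (Fin k)).edgeSet, p ((e : Sym2 (Fin k)).map f) =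
      pairProd (fun x y => p s(x, y)) f := by
  classical
  -- `Additive` lets a statement about sums over unordered pairs be used for products.
  have h := sum_sym2_filter_not_isDiag (M := Additive R) (univ : Finset (Fin k))
    (fun e => Additive.ofMul (p (e.map f)))
  replace h := congrArg Additive.toMul h
  simp only [toMul_sum, toMul_ofMul] at h
  rw [pairProd, ← Fintype.prod_prod_type', ← prod_filter]
  trans ∏ e ∈ (univ : Finset (Fin k)).sym2 with ¬ e.IsDiag, p (e.map f)
  · rw [prod_subtype (p := fun e => e ∈ (completeGraph (Fin k)).edgeSet)]
    intro e
    simp [completeGraph_eq_top]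
  · rw [h]
    refine prod_congr ?_ fun _ _ => rfl
    ext ⟨i, l⟩
    simp only [mem_filter, mem_offDiag, mem_univ, true_and, and_iff_right_iff_imp]
    exact ne_of_lt

end PairProd

/-! ### Part (i): subdivided complete graphs, by log-convexity. -/

section Clique

variable {W Z : Type*} [Fintype W] [Fintype Z]

/-- Jensen's inequality for powers and the uniform average. -/
theorem card_mul_average_pow_le_sum_pow {ι : Type*} [Fintype ι] [Nonempty ι] (f : ι → ℝ)
    (hf : ∀ i, 0 ≤ f i) (m : ℕ) :
    (Fintype.card ι : ℝ) * ((∑ i, f i) / Fintype.card ι) ^ m ≤ ∑ i, f i ^ m := by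
  have hn : (0 : ℝ) < Fintype.card ι := by exact_mod_cast Fintype.card_pos
  have h := Real.pow_arith_mean_le_arith_mean_pow univ (fun _ => (Fintype.card ι : ℝ)⁻¹) f
    (fun _ _ => by positivity) (by simp [hn.ne']) (fun i _ => hf i) m
  rw [← Finset.mul_sum, ← Finset.mul_sum, inv_mul_eq_div] at h
  calc _ ≤ (Fintype.card ι : ℝ) * ((Fintype.card ι : ℝ)⁻¹ * ∑ i, f i ^ m) := by gcongr
    _ = _ := by field_simp

/-- The number of homomorphisms from the subdivided complete graph on `j` vertices with `b` pendant
edges at each of the original vertices, for the weighted bipartite graph `a`. -/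
noncomputable def cliqueSum (a : W → Z → ℝ) (j b : ℕ) : ℝ :=
  ∑ x : Fin j → W, pairProd (fun u v => ∑ z, a u z * a v z) x * (∏ i, ∑ z, a (x i) z) ^ b

theorem sum_fin_succ_arrow {M : Type*} [AddCommMonoid M] {j : ℕ} (F : (Fin (j + 1) → W) → M) :
    ∑ x, F x = ∑ x : Fin j → W, ∑ y, F (Fin.cons y x) := by
  rw [← (Fin.consEquiv (fun _ => W)).sum_comp, Fintype.sum_prod_type_right]
  rfl

theorem cliqueSum_nonneg {a : W → Z → ℝ} (ha : ∀ x z, 0 ≤ a x z) (j b : ℕ) :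
    0 ≤ cliqueSum a j b := by
  refine sum_nonneg fun x _ => mul_nonneg (prod_nonneg fun i _ => prod_nonneg fun l _ => ?_)
    (pow_nonneg (prod_nonneg fun i _ => sum_nonneg fun z _ => ha _ _) _)
  split_ifs
  · exact sum_nonneg fun z _ => mul_nonneg (ha _ _) (ha _ _)
  · exact zero_le_one

theorem cliqueSum_zero (a : W → Z → ℝ) (b : ℕ) : cliqueSum a 0 b = 1 := by
  simp [cliqueSum, pairProd]

theorem cliqueSum_one (a : W → Z → ℝ) (b : ℕ) :
    cliqueSum a 1 b = ∑ x, (∑ z, a x z) ^ b := by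
  simp [cliqueSum, sum_fin_succ_arrow, pairProd]

/-- Cauchy-Schwarz: the numbers `cliqueSum a j (k - j)` form a log-convex sequence, up to a
factor. -/
theorem sq_cliqueSum_succ_le {a : W → Z → ℝ} (ha : ∀ x z, 0 ≤ a x z) (j b : ℕ) :
    cliqueSum a (j + 1) (b + 1) ^ 2 ≤
      Fintype.card Z * cliqueSum a j (b + 2) * cliqueSum a (j + 2) b := by
  set C : W → W → ℝ := fun u v => ∑ z, a u z * a v z with hC
  set d : W → ℝ := fun x => ∑ z, a x z with hd
  set D : (Fin j → W) → ℝ := fun x => ∏ i, d (x i) with hD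
  -- Total weight of the ways to attach one new main vertex `y` to the configuration `x`, with one
  -- pendant edge of `y` ending at the prescribed `z`.
  set g : (Fin j → W) → Z → ℝ := fun x z => ∑ y, a y z * (d y ^ b * ∏ i, C y (x i)) with hg
  have hP : ∀ x : Fin j → W, 0 ≤ pairProd C x := fun x =>
    prod_nonneg fun i _ => prod_nonneg fun l _ => by
      split_ifs
      · exact sum_nonneg fun z _ => mul_nonneg (ha _ _) (ha _ _)
      · exact zero_le_one
  have hD0 : ∀ x, 0 ≤ D x := fun x => prod_nonneg fun i _ => sum_nonneg fun z _ => ha _ _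
  have h0 : Fintype.card Z * cliqueSum a j (b + 2) =
      ∑ p : (Fin j → W) × Z, pairProd C p.1 * D p.1 ^ (b + 2) := by
    rw [Fintype.sum_prod_type]
    simp [cliqueSum, mul_sum, hD, hd, hC]
  have h1 : cliqueSum a (j + 1) (b + 1) =
      ∑ p : (Fin j → W) × Z, pairProd C p.1 * D p.1 ^ (b + 1) * g p.1 p.2 := by
    rw [Fintype.sum_prod_type, cliqueSum, sum_fin_succ_arrow]
    refine Finset.sum_congr rfl fun x _ => ?_
    change _ = ∑ z, pairProd C x * D x ^ (b + 1) * g x z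
    rw [← mul_sum, hg, sum_comm, mul_sum]
    refine Finset.sum_congr rfl fun y _ => ?_
    rw [pairProd_cons, Fin.prod_univ_succ, ← sum_mul]
    simp only [Fin.cons_zero, Fin.cons_succ]
    change _ * (d y * D x) ^ (b + 1) = _ * (d y * _)
    ring
  have h2 : cliqueSum a (j + 2) b =
      ∑ p : (Fin j → W) × Z, pairProd C p.1 * D p.1 ^ b * g p.1 p.2 ^ 2 := by
    rw [Fintype.sum_prod_type, cliqueSum, sum_fin_succ_arrow, sum_fin_succ_arrow]
    refine Finset.sum_congr rfl fun x _ => ?_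
    change _ = ∑ z, pairProd C x * D x ^ b * g x z ^ 2
    -- Two extensions `y`, `y'` sharing the end `z` have `z` as common neighbour; summing over `z`
    -- yields exactly the missing factor `C y' y`.
    have hsq : ∑ z, g x z ^ 2 = ∑ y, ∑ y', C y' y *
        ((d y ^ b * ∏ i, C y (x i)) * (d y' ^ b * ∏ i, C y' (x i))) := by
      simp_rw [hg, sq, sum_mul_sum]
      rw [sum_comm]
      refine Finset.sum_congr rfl fun y _ => ?_
      rw [sum_comm]
      refine Finset.sum_congr rfl fun y' _ => ?_
      rw [hC, sum_mul]
      exact Finset.sum_congr rfl fun z _ => by ring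
    rw [← mul_sum, hsq, mul_sum]
    refine Finset.sum_congr rfl fun y _ => ?_
    rw [mul_sum]
    refine Finset.sum_congr rfl fun y' _ => ?_
    rw [pairProd_cons, pairProd_cons, Fin.prod_univ_succ, Fin.prod_univ_succ, Fin.prod_univ_succ]
    simp only [Fin.cons_zero, Fin.cons_succ]
    change C y' y * _ * _ * (d y' * (d y * D x)) ^ b = _
    ring
  rw [h0, h1, h2]
  -- Cauchy-Schwarz over pairs `(x, z)` with weight `pairProd C x * D x ^ b`, applied to `D` and
  -- `g`. Since `D` does not depend on `z`, the factor `Fintype.card Z` appears.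
  refine sum_sq_le_sum_mul_sum_of_sq_le_mul _ (fun p _ => ?_) (fun p _ => ?_) (fun p _ => ?_)
  · exact mul_nonneg (hP _) (pow_nonneg (hD0 _) _)
  · exact mul_nonneg (mul_nonneg (hP _) (pow_nonneg (hD0 _) _)) (sq_nonneg _)
  · exact le_of_eq (by ring)

/-- Successive ratios `u (j+1) / u j` shrink by at most a factor `n`, so each is at least `u 1 / n ^
j`; their product telescopes, with exponent `0 + 1 + ⋯ + (k - 1)`. -/
theorem pow_le_of_sq_le_mul {u : ℕ → ℝ} {n : ℝ} (hn : 0 ≤ n) (hu : ∀ j, 0 ≤ u j) (h0 : u 0 = 1)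
    {k : ℕ} (h : ∀ j, j + 2 ≤ k → u (j + 1) ^ 2 ≤ n * u j * u (j + 2)) :
    u 1 ^ k ≤ n ^ k.choose 2 * u k := by
  have hstep : ∀ j, j + 1 ≤ k → u 1 * u j ≤ n ^ j * u (j + 1) := by
    intro j
    induction j with
    | zero => simp [h0]
    | succ j ih =>
      intro hj
      have h1 := ih (by omega)
      have h2 := h j hj
      -- The ratio argument divides by `u j`; if `u j = 0`, then `u (j + 1) = 0` too and the claim
      -- is trivial.
      rcases (hu j).eq_or_lt with h3 | h3
      · have : u (j + 1) = 0 := by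
          rw [← h3] at h2
          simpa using le_antisymm (by simpa using h2) (sq_nonneg (u (j + 1)))
        rw [this, mul_zero]
        exact mul_nonneg (pow_nonneg hn _) (hu _)
      · refine le_of_mul_le_mul_right ?_ h3
        calc u 1 * u (j + 1) * u j = u 1 * u j * u (j + 1) := by ring
          _ ≤ n ^ j * u (j + 1) * u (j + 1) := mul_le_mul_of_nonneg_right h1 (hu _)
          _ = n ^ j * u (j + 1) ^ 2 := by ring
          _ ≤ n ^ j * (n * u j * u (j + 2)) := mul_le_mul_of_nonneg_left h2 (pow_nonneg hn _)
          _ = n ^ (j + 1) * u (j + 1 + 1) * u j := by ring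
  have hall : ∀ j, j ≤ k → u 1 ^ j ≤ n ^ j.choose 2 * u j := by
    intro j
    induction j with
    | zero => simp [h0]
    | succ j ih =>
      intro hj
      calc u 1 ^ (j + 1) = u 1 ^ j * u 1 := pow_succ _ _
        _ ≤ n ^ j.choose 2 * u j * u 1 := mul_le_mul_of_nonneg_right (ih (by omega)) (hu _)
        _ = n ^ j.choose 2 * (u 1 * u j) := by ring
        _ ≤ n ^ j.choose 2 * (n ^ j * u (j + 1)) :=
          mul_le_mul_of_nonneg_left (hstep j hj) (pow_nonneg hn _)
        _ = n ^ (j + 1).choose 2 * u (j + 1) := by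
          rw [Nat.choose_succ_succ' j 1, Nat.choose_one_right, pow_add]
          ring
  exact hall k le_rfl

/-- The subdivision of a complete graph has Sidorenko's property. -/
theorem hasSidorenkoProperty_subdivision_completeGraph (k : ℕ) :
    (completeGraph (Fin k)).subdivision.HasSidorenkoProperty := by
  classical
  intro W _ G
  rcases isEmpty_or_nonempty W with hW | hW
  · exact sidorenko_of_isEmpty _ G
  have := Fintype.ofFinite W
  have hn : (0 : ℝ) < Fintype.card W := by exact_mod_cast Fintype.card_pos
  have hE : Nat.card (completeGraph (Fin k)).edgeSet = k.choose 2 := by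
    rw [Nat.card_eq_fintype_card, ← edgeFinset_card]
    simpa using card_edgeFinset_top_eq_card_choose_two (V := Fin k)
  have hchoose : (k - 1) * k = 2 * k.choose 2 := by
    rw [Nat.choose_two_right, Nat.mul_div_cancel' (Nat.even_mul_pred_self k).two_dvd, mul_comm]
  set a : W → W → ℝ := fun x z => if G.Adj x z then 1 else 0 with ha
  have ha0 : ∀ x z, 0 ≤ a x z := fun x z => by simp only [ha]; split_ifs <;> norm_num
  have hX : (Nat.card ((completeGraph (Fin k)).subdivision →g G) : ℝ) = cliqueSum a k 0 := by
    rw [card_subdivision_hom, cliqueSum]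
    push_cast
    refine Finset.sum_congr rfl fun f _ => ?_
    rw [prod_edgeSet_completeGraph k (fun s => (#(G.pairCommonNeighbors s) : ℝ))]
    simp only [card_pairCommonNeighbors_mk, pow_zero, mul_one, ha]
  have h1 : (Fintype.card W : ℝ) * (2 * Nat.card G.edgeSet / Fintype.card W) ^ (k - 1) ≤
      cliqueSum a 1 (k - 1) := by
    rw [cliqueSum_one, ← sum_degree_eq_two_mul_card_edgeSet]
    simp only [ha, sum_ite_adj]
    exact card_mul_average_pow_le_sum_pow _ (fun _ => Nat.cast_nonneg _) _
  -- With this choice of `b = k - j`, every main vertex keeps degree `k - 1` as `j` runs from `1` to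
  -- `k`.
  have h2 := pow_le_of_sq_le_mul (u := fun j => cliqueSum a j (k - j)) hn.le
    (fun j => cliqueSum_nonneg ha0 _ _) (cliqueSum_zero a _) (k := k) (fun j hj => by
      have := sq_cliqueSum_succ_le ha0 j (k - (j + 2))
      rwa [show k - (j + 2) + 1 = k - (j + 1) by omega,
        show k - (j + 2) + 2 = k - j by omega] at this)
  rw [hX, card_edgeSet_subdivision, Nat.card_sum, hE, Nat.card_eq_fintype_card,
    Nat.card_eq_fintype_card (α := Fin k), Fintype.card_fin]
  simp only [Nat.sub_self] at h2
  have h3 := (pow_le_pow_left₀ (by positivity) h1 k).trans h2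
  rw [mul_pow, ← pow_mul, hchoose] at h3
  -- As `k * (k - 1) = 2 * k.choose 2`, rewriting `2|E| / n` as `n` times the density yields `n ^ (2
  -- * k.choose 2)`: half cancels the Cauchy-Schwarz loss, half accounts for the new vertices.
  refine le_of_mul_le_mul_left (le_trans (le_of_eq ?_) h3) (pow_pos hn (k.choose 2))
  rw [sq, ← div_div, div_pow _ (Fintype.card W : ℝ), pow_add, pow_mul']
  field_simp
  ring

end Clique

/-! ### Part (ii): from graphs to kernels by blow-up and random sampling. -/

section Sampling

/-- The proportion of the colourings `c` of `ι` with `c s ∈ T s` for all `s ∈ S`. -/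
theorem card_filter_forall_mem_div {ι D : Type*} [Fintype ι] [DecidableEq ι] [Fintype D]
    [DecidableEq D] [Nonempty D] (S : Finset ι) (T : ι → Finset D) :
    (#{c : ι → D | ∀ s ∈ S, c s ∈ T s} : ℝ) / Fintype.card (ι → D) =
      ∏ s ∈ S, (#(T s) : ℝ) / Fintype.card D := by
  have hD : (Fintype.card D : ℝ) ≠ 0 := by exact_mod_cast Fintype.card_ne_zero
  have h : ({c : ι → D | ∀ s ∈ S, c s ∈ T s} : Finset (ι → D)) =
      Fintype.piFinset (fun s => if s ∈ S then T s else univ) := by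
    ext c
    simp only [mem_filter, mem_univ, true_and, Fintype.mem_piFinset]
    refine forall_congr' fun s => ?_
    by_cases hs : s ∈ S <;> simp [hs]
  rw [h, Fintype.card_piFinset, Fintype.card_fun, ← Finset.card_univ (α := ι)]
  push_cast
  rw [← Finset.prod_const, ← Finset.prod_div_distrib, ← Fintype.prod_ite_mem S]
  refine Finset.prod_congr rfl fun s _ => ?_
  by_cases hs : s ∈ S <;> simp [hs, hD]

theorem card_hom_eq_card_filter {V P : Type*} [Fintype V] [Fintype P] [DecidableEq V]
    (H : SimpleGraph V)
    (G : SimpleGraph P) [DecidablePred fun f : V → P => ∀ u v, H.Adj u v → G.Adj (f u) (f v)] :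
    Nat.card (H →g G) = #{f : V → P | ∀ u v, H.Adj u v → G.Adj (f u) (f v)} := by
  rw [← Fintype.card_subtype, ← Nat.card_eq_fintype_card]
  exact Nat.card_congr
    { toFun := fun g => ⟨g, fun _ _ h => g.map_adj h⟩
      invFun := fun f => ⟨f.1, fun {u v} h => f.2 u v h⟩
      left_inv := fun _ => rfl
      right_inv := fun _ => rfl }

variable {V : Type*} [Fintype V] [DecidableEq V] {P D : Type} [Fintype P] [Fintype D] [Nonempty D]

/-- The expected number of homomorphisms into a random graph with prescribed edge probabilities. -/
theorem average_card_hom_le (H : SimpleGraph V) [Fintype H.edgeSet] [DecidableEq P]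
    (T : Sym2 P → Finset D) :
    (∑ c : Sym2 P → D, (Nat.card (H →g fromEdgeSet {s | c s ∈ T s}) : ℝ)) /
        Fintype.card (Sym2 P → D) ≤
      ∑ f : V → P, ∏ e : H.edgeSet, (#(T ((e : Sym2 V).map f)) : ℝ) / Fintype.card D +
        ((Fintype.card P : ℝ) ^ Fintype.card V -
          (Fintype.card P).descFactorial (Fintype.card V)) := by
  classical
  have hL : (0 : ℝ) < Fintype.card (Sym2 P → D) := by exact_mod_cast Fintype.card_pos
  have hnoninj : (Fintype.card P : ℝ) ^ Fintype.card V -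
      (Fintype.card P).descFactorial (Fintype.card V) =
      ∑ f : V → P, if Function.Injective f then 0 else 1 := by
    have h1 : ((Fintype.card P).descFactorial (Fintype.card V) : ℝ) =
        ∑ f : V → P, if Function.Injective f then 1 else 0 := by
      rw [Finset.sum_boole, ← Fintype.card_embedding_eq, ← Fintype.card_subtype]
      exact_mod_cast (Fintype.card_congr (Equiv.subtypeInjectiveEquivEmbedding V P)).symm
    have h2 : (Fintype.card P : ℝ) ^ Fintype.card V = ∑ f : V → P, 1 := by simp
    rw [h1, h2, ← Finset.sum_sub_distrib]
    exact Finset.sum_congr rfl fun f _ => by split_ifs <;> simp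
  rw [hnoninj, ← Finset.sum_add_distrib]
  simp_rw [card_hom_eq_card_filter, ← Finset.sum_boole (R := ℝ)]
  rw [Finset.sum_comm, Finset.sum_div]
  refine Finset.sum_le_sum fun f _ => ?_
  rw [Finset.sum_boole]
  -- An injective `f` sends distinct edges to distinct pairs, whose colours are independent. For
  -- other `f` the probability is only bounded by one, which the error term pays for.
  by_cases hf : Function.Injective f
  · rw [if_pos hf, add_zero, ← Finset.prod_image (s := univ)
      (g := fun e : H.edgeSet => (e : Sym2 V).map f)
      (f := fun s => (#(T s) : ℝ) / Fintype.card D)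
      (fun e _ e' _ h => Subtype.ext (Sym2.map.injective hf h)), ← card_filter_forall_mem_div]
    gcongr with c
    intro hc s hs
    obtain ⟨⟨e, he⟩, -, rfl⟩ := Finset.mem_image.1 hs
    induction e using Sym2.ind with
    | _ u v => exact ((fromEdgeSet_adj _).1 (hc u v he)).1
  · rw [if_neg hf]
    have h1 : (0 : ℝ) ≤ ∏ e : H.edgeSet, (#(T ((e : Sym2 V).map f)) : ℝ) / Fintype.card D :=
      prod_nonneg fun _ _ => by positivity
    refine le_trans (div_le_one_of_le₀ ?_ hL.le) (le_add_of_nonneg_left h1)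
    exact_mod_cast Finset.card_le_univ _

/-- The expected number of edges of a random graph with prescribed edge probabilities. -/
theorem average_two_mul_card_edgeSet [DecidableEq P] (T : Sym2 P → Finset D) :
    (∑ c : Sym2 P → D, 2 * (Nat.card (fromEdgeSet {s | c s ∈ T s}).edgeSet : ℝ)) /
        Fintype.card (Sym2 P → D) =
      ∑ p, ∑ q, if p ≠ q then (#(T s(p, q)) : ℝ) / Fintype.card D else 0 := by
  classical
  simp_rw [← sum_degree_eq_two_mul_card_edgeSet, ← sum_ite_adj]
  rw [Finset.sum_comm, Finset.sum_div]
  refine Finset.sum_congr rfl fun p _ => ?_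
  rw [Finset.sum_comm, Finset.sum_div]
  refine Finset.sum_congr rfl fun q _ => ?_
  by_cases hpq : p = q
  · simp [hpq]
  · have h := card_filter_forall_mem_div {s(p, q)} T
    rw [Finset.prod_singleton] at h
    rw [if_pos hpq, ← h, Finset.sum_boole]
    simp [hpq]

/-- Average Sidorenko's inequality over all colourings `c`, a pair `s` being an edge when `c s ∈ T
s`; Jensen moves the average inside the power. -/
theorem HasSidorenkoProperty.random {H : SimpleGraph V} [Fintype H.edgeSet] [DecidableEq P]
    (hH : H.HasSidorenkoProperty) (T : Sym2 P → Finset D) :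
    (Fintype.card P : ℝ) ^ Fintype.card V *
        ((∑ p, ∑ q, if p ≠ q then (#(T s(p, q)) : ℝ) / Fintype.card D else 0) /
          (Fintype.card P : ℝ) ^ 2) ^ Fintype.card H.edgeSet ≤
      ∑ f : V → P, ∏ e : H.edgeSet, (#(T ((e : Sym2 V).map f)) : ℝ) / Fintype.card D +
        ((Fintype.card P : ℝ) ^ Fintype.card V -
          (Fintype.card P).descFactorial (Fintype.card V)) := by
  classical
  have hL : (0 : ℝ) < Fintype.card (Sym2 P → D) := by exact_mod_cast Fintype.card_pos
  refine le_trans ?_ (average_card_hom_le H T)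
  rw [← average_two_mul_card_edgeSet, le_div_iff₀ hL, div_right_comm, Finset.sum_div, mul_assoc,
    mul_comm (_ ^ _) (Fintype.card (Sym2 P → D) : ℝ)]
  refine le_trans (mul_le_mul_of_nonneg_left (card_mul_average_pow_le_sum_pow _
    (fun c => by positivity) _) (by positivity)) ?_
  rw [Finset.mul_sum]
  refine Finset.sum_le_sum fun c _ => ?_
  have := hH P (fromEdgeSet {s | c s ∈ T s})
  simpa only [Nat.card_eq_fintype_card (α := P), Nat.card_eq_fintype_card (α := V),
    Nat.card_eq_fintype_card (α := H.edgeSet)] using this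

/-- Division by `(n * M) ^ v` leaves the kernel inequality with errors from discarded pairs and
non-injective maps, both depending on `M` only through `1 / M`. -/
theorem normalize_blowup_inequality {n M A B X d : ℝ} {v e : ℕ} (hn : 0 < n) (hM : 1 ≤ M)
    (hA : 0 ≤ A) (hB : M * (M - 1) * A ≤ B) (hd : (n * M - v) ^ v ≤ d)
    (h : (n * M) ^ v * (B / (n * M) ^ 2) ^ e ≤ M ^ v * X + ((n * M) ^ v - d)) :
    ((1 - 1 / M) * (A / n ^ 2)) ^ e ≤ X / n ^ v + (1 - (1 - v / n * (1 / M)) ^ v) := by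
  have hM0 : 0 < M := by linarith
  have hNv : 0 < (n * M) ^ v := by positivity
  refine le_of_mul_le_mul_left ?_ hNv
  calc (n * M) ^ v * ((1 - 1 / M) * (A / n ^ 2)) ^ e
      = (n * M) ^ v * (M * (M - 1) * A / (n * M) ^ 2) ^ e := by
        congr 2
        field_simp
    _ ≤ (n * M) ^ v * (B / (n * M) ^ 2) ^ e := by
        have : 0 ≤ M * (M - 1) * A := mul_nonneg (mul_nonneg hM0.le (sub_nonneg.2 hM)) hA
        gcongr
    _ ≤ M ^ v * X + ((n * M) ^ v - (n * M - v) ^ v) := by linarith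
    _ = (n * M) ^ v * (X / n ^ v + (1 - (1 - v / n * (1 / M)) ^ v)) := by
        have h1 : n * M - v = n * M * (1 - v / n * (1 / M)) := by field_simp
        rw [h1]
        generalize 1 - v / n * (1 / M) = t
        rw [mul_pow _ t, mul_pow]
        field_simp

/-- Sidorenko's inequality passes from graphs to kernels with values in `[0, 1]`, loops
included. -/
theorem HasSidorenkoProperty.kernel {W : Type} [Fintype W] [Nonempty W] {H : SimpleGraph V}
    [Fintype H.edgeSet] (hH : H.HasSidorenkoProperty) (T : Sym2 W → Finset D) :
    (Fintype.card W : ℝ) ^ Fintype.card V *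
        ((∑ x, ∑ y, (#(T s(x, y)) : ℝ) / Fintype.card D) /
          (Fintype.card W : ℝ) ^ 2) ^ Fintype.card H.edgeSet ≤
      ∑ f : V → W, ∏ e : H.edgeSet, (#(T ((e : Sym2 V).map f)) : ℝ) / Fintype.card D := by
  classical
  have hn : (0 : ℝ) < Fintype.card W := by exact_mod_cast Fintype.card_pos
  set n : ℝ := (Fintype.card W : ℝ) with hn_def
  set v := Fintype.card V with hv
  set A : ℝ := ∑ x, ∑ y, (#(T s(x, y)) : ℝ) / Fintype.card D with hA
  set X : ℝ := ∑ f : V → W, ∏ e : H.edgeSet, (#(T ((e : Sym2 V).map f)) : ℝ) / Fintype.card D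
    with hX
  have hA0 : 0 ≤ A := sum_nonneg fun _ _ => sum_nonneg fun _ _ => by positivity
  have key : ∀ M : ℕ, 1 ≤ M → v ≤ M →
      ((1 - 1 / (M : ℝ)) * (A / n ^ 2)) ^ Fintype.card H.edgeSet ≤
        X / n ^ v + (1 - (1 - v / n * (1 / (M : ℝ))) ^ v) := by
    intro M hM hvM
    have hM0 : (0 : ℝ) < M := by exact_mod_cast hM
    have hM1 : (1 : ℝ) ≤ M := by exact_mod_cast hM
    have h := hH.random (P := W × Fin M) (fun s => T (s.map Prod.fst))
    have hcard : (Fintype.card (W × Fin M) : ℝ) = n * M := by simp [hn_def]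
    have hedge : (M : ℝ) * (M - 1) * A ≤ ∑ p : W × Fin M, ∑ q : W × Fin M,
        if p ≠ q then (#(T (s(p, q).map Prod.fst)) : ℝ) / Fintype.card D else 0 := by
      -- Only pairs with different copy indices are kept. Two copies of the same vertex of `W` then
      -- still count, which is how the diagonal of the kernel survives in loopless graphs.
      have h1 : (M : ℝ) * (M - 1) * A = ∑ p : W × Fin M, ∑ q : W × Fin M,
          if p.2 ≠ q.2 then (#(T (s(p, q).map Prod.fst)) : ℝ) / Fintype.card D else 0 := by
        simp_rw [Fintype.sum_prod_type, Sym2.map_mk, Finset.sum_ite, Finset.sum_const_zero,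
          add_zero, Finset.sum_const, Finset.filter_ne, Finset.card_erase_of_mem (mem_univ _)]
        simp [hA, Nat.cast_sub hM, Finset.mul_sum, mul_assoc]
      rw [h1]
      refine sum_le_sum fun p _ => sum_le_sum fun q _ => ?_
      by_cases hpq : p.2 = q.2
      · rw [if_neg (not_not.2 hpq)]
        split_ifs <;> positivity
      · rw [if_pos hpq, if_pos (fun h => hpq (congrArg Prod.snd h))]
    have hhom : ∑ f : V → W × Fin M, ∏ e : H.edgeSet,
        (#(T (((e : Sym2 V).map f).map Prod.fst)) : ℝ) / Fintype.card D = (M : ℝ) ^ v * X := by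
      rw [← (Equiv.arrowProdEquivProdArrow V (fun _ => W) (fun _ => Fin M)).symm.sum_comp,
        Fintype.sum_prod_type_right]
      simp_rw [Sym2.map_map]
      change ∑ _b : V → Fin M, X = _
      simp [hv]
    have hdesc : (n * M - v) ^ v ≤ ((Fintype.card (W × Fin M)).descFactorial v : ℝ) := by
      have h1 := Nat.pow_sub_le_descFactorial (Fintype.card (W × Fin M)) v
      have h2 : v ≤ Fintype.card (W × Fin M) := by
        simpa using hvM.trans (Nat.le_mul_of_pos_left M Fintype.card_pos)
      have h3 : (Fintype.card (W × Fin M) - v) ^ v ≤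
          (Fintype.card (W × Fin M)).descFactorial v :=
        (Nat.pow_le_pow_left (by omega) v).trans h1
      rw [← hcard, ← Nat.cast_sub h2]
      exact_mod_cast h3
    rw [hhom, hcard] at h
    exact normalize_blowup_inequality hn hM1 hA0 hedge hdesc h
  have hlim := tendsto_one_div_atTop_nhds_zero_nat (𝕜 := ℝ)
  have hl : Tendsto (fun M : ℕ => ((1 - 1 / (M : ℝ)) * (A / n ^ 2)) ^ Fintype.card H.edgeSet)
      atTop (𝓝 (((1 - 0) * (A / n ^ 2)) ^ Fintype.card H.edgeSet)) :=
    ((tendsto_const_nhds.sub hlim).mul tendsto_const_nhds).pow _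
  have hr : Tendsto (fun M : ℕ => X / n ^ v + (1 - (1 - v / n * (1 / (M : ℝ))) ^ v))
      atTop (𝓝 (X / n ^ v + (1 - (1 - v / n * 0) ^ v))) :=
    tendsto_const_nhds.add (tendsto_const_nhds.sub
      ((tendsto_const_nhds.sub (tendsto_const_nhds.mul hlim)).pow _))
  have hfin := le_of_tendsto_of_tendsto hl hr (by
    filter_upwards [eventually_ge_atTop 1, eventually_ge_atTop v] with M h1 h2 using key M h1 h2)
  simp only [sub_zero, one_mul, mul_zero, one_pow, sub_self, add_zero] at hfin
  rwa [le_div_iff₀ (by positivity), mul_comm] at hfin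

end Sampling

/-- The subdivision of a graph with Sidorenko's property has Sidorenko's property. -/
theorem HasSidorenkoProperty.subdivision {V : Type*} [Finite V] {H : SimpleGraph V}
    (hH : H.HasSidorenkoProperty) : H.subdivision.HasSidorenkoProperty := by
  classical
  intro W _ G
  rcases isEmpty_or_nonempty W with hW | hW
  · exact sidorenko_of_isEmpty _ G
  have := Fintype.ofFinite V
  have := Fintype.ofFinite W
  have hn : (0 : ℝ) < Fintype.card W := by exact_mod_cast Fintype.card_pos
  -- Here `D` is `W` itself, so the kernel is the codegree divided by `n`; the `n`'s in the
  -- denominators, one per edge of `H`, match the new vertices of the subdivision.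
  have h := hH.kernel G.pairCommonNeighbors
  -- The mean codegree is controlled by the sum of squared degrees, hence by the square of the mean
  -- degree.
  have hdeg := card_mul_average_pow_le_sum_pow (fun x => (G.degree x : ℝ))
    (fun _ => Nat.cast_nonneg _) 2
  rw [← sum_card_pairCommonNeighbors, sum_degree_eq_two_mul_card_edgeSet] at hdeg
  simp_rw [Finset.prod_div_distrib, ← Finset.sum_div, Finset.prod_const, Finset.card_univ] at h
  rw [card_edgeSet_subdivision, card_subdivision_hom, Nat.card_sum]
  push_cast
  simp only [Nat.card_eq_fintype_card (α := W), Nat.card_eq_fintype_card (α := V),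
    Nat.card_eq_fintype_card (α := H.edgeSet)]
  rw [le_div_iff₀ (by positivity)] at h
  refine le_trans ?_ h
  rw [pow_add, pow_mul, mul_assoc, mul_assoc, mul_comm (_ ^ Fintype.card H.edgeSet)]
  gcongr
  rw [div_div, le_div_iff₀ (by positivity)]
  refine le_trans (le_of_eq ?_) hdeg
  field_simp

end SimpleGraph

theorem theorem2 :
    (∀ k : ℕ, 0 < k → (SimpleGraph.completeGraph (Fin k)).subdivision.HasSidorenkoProperty) ∧
    (∀ (V : Type*) [Finite V] (H : SimpleGraph V),
      H.HasSidorenkoProperty → H.subdivision.HasSidorenkoProperty) :=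
  ⟨fun k _ => SimpleGraph.hasSidorenkoProperty_subdivision_completeGraph k,
    fun _ _ _ hH => hH.subdivision⟩
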